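/- Let $n\ge 0$ and let $S_n$ be the set of permutations $\pi=\pi_1\pi_2\cdots\pi_n$ of $\{1,\dots,n\}$. An index $i\in\{1,\dots,n-1\}$ is an alternating descent of $\pi$ if $i$ is odd and $\pi_i>\pi_{i+1}$, or $i$ is even and $\pi_i<\pi_{i+1}$. Let $\operatorname{altdes}(\pi)$ be the number of alternating descents of $\pi$, and let $\operatorname{altmaj}(\pi)$ be the sum of the alternating descents of $\pi$. Let $\sec$ and $\tan$ denote the formal power series $1/\cos$ and $\sin/\cos$. Theorem (Remmel). Let $K$ be a field of characteristic $0$. In the ring $K[[x,t,q]]$ of formal power series, $$\sum_{n=0}^\infty \frac{x^n}{n!}\,\frac{\sum_{\pi\in S_n} t^{\operatorname{altdes}(\pi)}q^{\operatorname{altmaj}(\pi)}}{(1-t)(1-tq)\cdots(1-tq^n)}=\sum_{k=0}^\infty t^k\prod_{j=0}^k\bigl(\sec(xq^j)+\tan(xq^j)\bigr),$$ where both infinite sums converge coefficientwise (each monomial occurs with nonzero coefficient in only finitely many summands). -/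

import Mathlib

open scoped MvPowerSeries.WithPiTopology

/-- `i` is an alternating descent of `π = π₁π₂⋯πₙ` (positions `1, …, n`): `1 ≤ i ≤ n - 1`, and
either `i` is odd and `πᵢ > πᵢ₊₁`, or `i` is even and `πᵢ < πᵢ₊₁`. The permutation acts on
`Fin n = {0, …, n - 1}`, so that `πᵢ` is the value at the index `a` with `a + 1 = i`,
and `πᵢ₊₁` is the value at the index `b` with `b = i`. -/
def IsAltDescent {n : ℕ} (π : Equiv.Perm (Fin n)) (i : ℕ) : Prop :=
  ∃ a b : Fin n, (a : ℕ) + 1 = i ∧ (b : ℕ) = i ∧ ((Odd i ∧ π b < π a) ∨ (Even i ∧ π a < π b))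

instance {n : ℕ} (π : Equiv.Perm (Fin n)) (i : ℕ) : Decidable (IsAltDescent π i) := by
  unfold IsAltDescent; infer_instance

/-- The set of alternating descents of `π`, as a subset of `{1, …, n - 1}`. -/
def altDescents {n : ℕ} (π : Equiv.Perm (Fin n)) : Finset ℕ :=
  (Finset.Ico 1 n).filter (fun i => IsAltDescent π i)

/-- The number of alternating descents of `π`. -/
def altdes {n : ℕ} (π : Equiv.Perm (Fin n)) : ℕ := (altDescents π).card

/-- The alternating major index of `π`: the sum of its alternating descents. -/
def altmaj {n : ℕ} (π : Equiv.Perm (Fin n)) : ℕ := ∑ i ∈ altDescents π, i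

/-- The formal power series of the secant, `1 / cos`. -/
noncomputable def secSeries (K : Type*) [Field K] [CharZero K] : PowerSeries K :=
  (PowerSeries.cos K)⁻¹

/-- The formal power series of the tangent, `sin / cos`. -/
noncomputable def tanSeries (K : Type*) [Field K] [CharZero K] : PowerSeries K :=
  PowerSeries.sin K * (PowerSeries.cos K)⁻¹

/-- The indeterminate `x` of `K⟦x, t, q⟧`. -/
noncomputable def varX (K : Type*) [Field K] : MvPowerSeries (Fin 3) K := MvPowerSeries.X 0

/-- The indeterminate `t` of `K⟦x, t, q⟧`. -/
noncomputable def varT (K : Type*) [Field K] : MvPowerSeries (Fin 3) K := MvPowerSeries.X 1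

/-- The indeterminate `q` of `K⟦x, t, q⟧`. -/
noncomputable def varQ (K : Type*) [Field K] : MvPowerSeries (Fin 3) K := MvPowerSeries.X 2

/-- The `n`-th term of the left-hand side,
`(xⁿ / n!) * (∑ over π in Sₙ of t ^ altdes π * q ^ altmaj π) / ((1 - t)(1 - tq)⋯(1 - tqⁿ))`. -/
noncomputable def altTerm (K : Type*) [Field K] (n : ℕ) : MvPowerSeries (Fin 3) K :=
  ((n.factorial : K)⁻¹ • varX K ^ n) *
    ((∑ π : Equiv.Perm (Fin n), varT K ^ altdes π * varQ K ^ altmaj π) *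
      (∏ i ∈ Finset.range (n + 1), (1 - varT K * varQ K ^ i))⁻¹)

/-- The `k`-th term of the right-hand side,
`t ^ k * ∏ over 0 ≤ j ≤ k of (sec (x q ^ j) + tan (x q ^ j))`. -/
noncomputable def secTanTerm (K : Type*) [Field K] [CharZero K] (k : ℕ) :
    MvPowerSeries (Fin 3) K :=
  varT K ^ k * ∏ j ∈ Finset.range (k + 1),
    (PowerSeries.subst (varX K * varQ K ^ j) (secSeries K) +
      PowerSeries.subst (varX K * varQ K ^ j) (tanSeries K))

/-!
Both sides are the two iterated sums of one double family. Write `F = sec + tan` and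
`Hₖ = F(x) F(qx) ⋯ F(qᵏ x)`. The family is `tᵏ xⁿ [xⁿ] Hₖ`: summing over `n` gives the `k`-th term
of the right-hand side (`hasSum_doubleTerm_secTanTerm`), and summing over `k` gives the `n`-th term
of the left-hand side (`hasSum_doubleTerm_altTerm`). The second statement carries the content: with
`Aₙ(t) = ∑ₖ tᵏ n! [xⁿ] Hₖ` it says that `Dₙ(t) = (1 - t)(1 - qt) ⋯ (1 - qⁿ t) Aₙ(t)` equals
`Pₙ(t) = ∑ t ^ altdes π q ^ altmaj π`. Here `D₀ = P₀ = 1`, and the two families satisfy the same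
recurrence.

*Permutations.* Cut a permutation of `n + 1` letters at its largest letter, with `b` letters on the
left and `n - b` on the right. Both positions next to it are alternating descents if its position
`b + 1` is odd, and neither is if `b + 1` is even. For the smallest letter the parities are
exchanged. The weight of a word depends on the parity of its starting position, but adding the two
recurrences removes this dependence by induction (`totalWeight_eq_of_recurrence`), and leaves
`2 Pₙ₊₁(t) = ∑_b (n choose b) (1 + c) P_b(t) Pₙ₋_b(q ^ (b + 1) t)`,
where `c` is the product of `t q ^ b` (if `b ≠ 0`) and `t q ^ (b + 1)` (if `b ≠ n`).

*Series.* The Riccati equation `2 F' = 1 + F²` turns `2 Hₖ'` into the sum over `j` of the products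
obtained by deleting or by doubling the factor `F(q ^ j x)` of `Hₖ`; either product splits at `j`
into two shorter products of the same kind (`two_mul_derivative_qProd`). Taking coefficients gives
the recurrence for `Aₙ`, where the deleted factor accounts for `c` and the doubled one for `1`; the
denominators split in the same way, so the recurrence passes to `Dₙ` (`two_mul_qNumerator_succ`).
-/

/-! ### Words and their alternating weight -/

section Words

variable {α : Type*} [LinearOrder α]

/-- The alternating descent condition at position `p` for consecutive letters `a`, `b`. -/
def AltDrop (p : ℕ) (a b : α) : Prop := (Odd p ∧ b < a) ∨ (Even p ∧ a < b)

instance (p : ℕ) (a b : α) : Decidable (AltDrop p a b) := by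
  unfold AltDrop; infer_instance

variable {A : Type*} [CommRing A]

/-- The weight of a word whose first letter sits at position `p`: the product of `t * q ^ i` over
the alternating descents `i` of the word. -/
def altWeight (t q : A) : ℕ → List α → A
  | _, [] => 1
  | _, [_] => 1
  | p, a :: b :: l => (if AltDrop p a b then t * q ^ p else 1) * altWeight t q (p + 1) (b :: l)

/-- The words in which every element of `s` occurs exactly once and no other letter occurs. -/
def arrangements (s : Finset α) : Finset (List α) := (Multiset.lists s.val).toFinset

theorem mem_arrangements {s : Finset α} {l : List α} :
    l ∈ arrangements s ↔ l.Nodup ∧ l.toFinset = s := by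
  rw [arrangements, Multiset.mem_toFinset, Multiset.mem_lists_iff]
  constructor
  · intro h
    have h' : s.val = (l : Multiset α) := h
    have hn : l.Nodup := by rw [← Multiset.coe_nodup, ← h']; exact s.nodup
    refine ⟨hn, ?_⟩
    ext a
    rw [List.mem_toFinset, ← Multiset.mem_coe, ← h', Finset.mem_val]
  · rintro ⟨hn, rfl⟩
    change _ = (l : Multiset α)
    rw [List.toFinset_val, hn.dedup]

theorem length_of_mem_arrangements {s : Finset α} {l : List α} (h : l ∈ arrangements s) :
    l.length = s.card := by
  rw [mem_arrangements] at h
  rw [← h.2, List.toFinset_card_of_nodup h.1]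

/-- Splitting a word at a letter `m` cuts its weight into the weights of the two sides, up to the
contributions of the two positions next to `m`, both of which are alternating descents when the
position of `m` satisfies `Q` and neither of which is otherwise. -/
theorem altWeight_append_cons (t q : A) (Q : ℕ → Prop) [DecidablePred Q] (m : α)
    (l₁ l₂ : List α) (p : ℕ)
    (h₁ : ∀ a ∈ l₁, ∀ i, AltDrop i a m ↔ Q (i + 1)) (h₂ : ∀ a ∈ l₂, ∀ i, AltDrop i m a ↔ Q i) :
    altWeight t q (p + 1) (l₁ ++ m :: l₂) =
      (if Q (p + l₁.length + 1) then (if l₁.length = 0 then 1 else t * q ^ (p + l₁.length)) *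
        (if l₂.length = 0 then 1 else t * q ^ (p + l₁.length + 1)) else 1) *
      (altWeight t q (p + 1) l₁ * altWeight t q (p + l₁.length + 1 + 1) l₂) := by
  induction l₁ generalizing p with
  | nil =>
    cases l₂ with
    | nil => simp [altWeight]
    | cons b l =>
      simp only [List.nil_append, altWeight, h₂ b (by simp)]
      simp
  | cons a l₁ ih =>
    have ih' := ih (p + 1) (fun a ha => h₁ a (by simp [ha]))
    have e1 : p + 1 + l₁.length = p + (a :: l₁).length := by simp; omega
    rw [e1] at ih'
    cases l₁ with
    | nil =>
      simp only [List.cons_append, List.nil_append, altWeight, h₁ a (by simp)] at ih' ⊢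
      rw [ih']
      simp only [List.length_cons, List.length_nil, zero_add, one_ne_zero, if_false, if_true]
      split_ifs <;> ring
    | cons b l =>
      simp only [List.cons_append] at ih' ⊢
      simp only [altWeight]
      rw [ih']
      simp only [List.length_cons, Nat.add_eq_zero_iff, one_ne_zero, and_false, if_false]
      ring

/-- Cutting the arrangements of `insert m s` at the letter `m`. -/
theorem sum_arrangements_insert {M : Type*} [AddCommMonoid M] (f : List α → M) (m : α)
    (s : Finset α) (hm : m ∉ s) :
    ∑ l ∈ arrangements (insert m s), f l = ∑ T ∈ s.powerset, ∑ l₁ ∈ arrangements T,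
      ∑ l₂ ∈ arrangements (s \ T), f (l₁ ++ m :: l₂) := by
  have : ∀ T ∈ s.powerset, ∑ l₁ ∈ arrangements T, ∑ l₂ ∈ arrangements (s \ T), f (l₁ ++ m :: l₂)
      = ∑ x ∈ arrangements T ×ˢ arrangements (s \ T), f (x.1 ++ m :: x.2) :=
    fun T _ => (Finset.sum_product' _ _ (fun l₁ l₂ => f (l₁ ++ m :: l₂))).symm
  rw [Finset.sum_congr rfl this, Finset.sum_sigma']
  symm
  refine Finset.sum_bij (fun x _ => x.2.1 ++ m :: x.2.2) ?_ ?_ ?_ (fun _ _ => rfl)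
  · rintro ⟨T, l₁, l₂⟩ h
    simp only [Finset.mem_sigma, Finset.mem_powerset, Finset.mem_product, mem_arrangements] at h ⊢
    obtain ⟨hT, ⟨n1, e1⟩, n2, e2⟩ := h
    have k1 : ∀ a, a ∈ l₁ ↔ a ∈ T := fun a => by rw [← e1, List.mem_toFinset]
    have k2 : ∀ a, a ∈ l₂ ↔ a ∈ s ∧ a ∉ T := fun a => by
      rw [← List.mem_toFinset, e2, Finset.mem_sdiff]
    constructor
    · rw [List.nodup_middle, List.nodup_cons, List.nodup_append', List.mem_append, k1, k2]
      refine ⟨fun h => hm (h.elim (fun h => hT h) (fun h => h.1)), n1, n2, ?_⟩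
      intro a ha hb
      exact ((k2 a).1 hb).2 ((k1 a).1 ha)
    · ext a
      simp only [List.mem_toFinset, List.mem_append, List.mem_cons, k1, k2, Finset.mem_insert]
      have := @hT a
      tauto
  · rintro ⟨T, l₁, l₂⟩ h ⟨T', l₁', l₂'⟩ h' he
    simp only [Finset.mem_sigma, Finset.mem_powerset, Finset.mem_product, mem_arrangements]
      at h h' he
    obtain ⟨hT, ⟨n1, e1⟩, n2, e2⟩ := h
    obtain ⟨hT', ⟨n1', e1'⟩, n2', e2'⟩ := h'
    have a1 : m ∉ l₁ := fun h => hm (hT (by rw [← e1]; simpa using h))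
    have a2 : m ∉ l₂ := fun h => hm (Finset.sdiff_subset (by rw [← e2]; simpa using h))
    obtain ⟨rfl, -, rfl⟩ := (List.append_cons_inj_of_notMem a1 a2).1 he
    subst e1
    subst e1'
    rfl
  · intro l hl
    rw [mem_arrangements] at hl
    obtain ⟨n, e⟩ := hl
    have : m ∈ l := by rw [← List.mem_toFinset, e]; simp
    obtain ⟨l₁, l₂, rfl⟩ := List.append_of_mem this
    rw [List.nodup_middle, List.nodup_cons, List.nodup_append', List.mem_append] at n
    obtain ⟨nm, n1, n2, nd⟩ := n
    have key : ∀ a, a ∈ l₁ ∨ a = m ∨ a ∈ l₂ ↔ a = m ∨ a ∈ s := fun a => by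
      have := Finset.ext_iff.1 e a
      simp only [List.mem_toFinset, List.mem_append, List.mem_cons, Finset.mem_insert] at this
      exact this
    have hs : ∀ a, a ∈ s ↔ a ∈ l₁ ∨ a ∈ l₂ := fun a => by
      have := key a
      by_cases ham : a = m
      · subst ham; tauto
      · tauto
    refine ⟨⟨l₁.toFinset, l₁, l₂⟩, ?_, rfl⟩
    simp only [Finset.mem_sigma, Finset.mem_powerset, Finset.mem_product]
    rw [mem_arrangements, mem_arrangements]
    refine ⟨fun a ha => (hs a).2 (Or.inl (by simpa using ha)), ⟨n1, rfl⟩, n2, ?_⟩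
    ext a
    rw [Finset.mem_sdiff, hs, List.mem_toFinset, List.mem_toFinset]
    have := @nd a
    tauto

/-- The total weight of the arrangements of `s`, the first letter being at position `p + 1`. -/
def totalWeight (t q : A) (p : ℕ) (s : Finset α) : A :=
  ∑ l ∈ arrangements s, altWeight t q (p + 1) l

/-- The weight contributed by the two positions next to a letter, when both are alternating
descents. The letter has `b` letters on its left and `a` on its right, and the first letter of the
word is at position `p + 1`; a position exists only if there is a letter on that side. -/
def cutWeight (t q : A) (p b a : ℕ) : A :=
  (if b = 0 then 1 else t * q ^ (p + b)) * (if a = 0 then 1 else t * q ^ (p + b + 1))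

/-- Cutting at an extreme letter `m` of `insert m s`: both positions next to `m` are alternating
descents when the position of `m` satisfies `Q`, and neither is otherwise. -/
theorem totalWeight_insert (t q : A) (Q : ℕ → Prop) [DecidablePred Q] (m : α) (s : Finset α)
    (hm : m ∉ s) (p : ℕ)
    (h₁ : ∀ a ∈ s, ∀ i, AltDrop i a m ↔ Q (i + 1)) (h₂ : ∀ a ∈ s, ∀ i, AltDrop i m a ↔ Q i) :
    totalWeight t q p (insert m s) = ∑ T ∈ s.powerset,
      (if Q (p + T.card + 1) then cutWeight t q p T.card (s.card - T.card) else 1) *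
      (totalWeight t q p T * totalWeight t q (p + T.card + 1) (s \ T)) := by
  rw [totalWeight, sum_arrangements_insert _ _ _ hm]
  refine Finset.sum_congr rfl fun T hT => ?_
  rw [Finset.mem_powerset] at hT
  rw [totalWeight, totalWeight, Finset.sum_mul_sum, Finset.mul_sum]
  refine Finset.sum_congr rfl fun l₁ hl₁ => ?_
  rw [Finset.mul_sum]
  refine Finset.sum_congr rfl fun l₂ hl₂ => ?_
  have c1 := length_of_mem_arrangements hl₁
  have c2 := length_of_mem_arrangements hl₂
  rw [Finset.card_sdiff_of_subset hT] at c2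
  rw [mem_arrangements] at hl₁ hl₂
  rw [altWeight_append_cons t q Q m l₁ l₂ p
    (fun a ha => h₁ a (hT (by rw [← hl₁.2]; simpa using ha)))
    (fun a ha => h₂ a (Finset.sdiff_subset (by rw [← hl₂.2]; simpa using ha))), c1, c2, cutWeight]

/-- A family satisfying the averaged recurrence computes the total weights. The largest letter of
a word causes alternating descents on both its sides when its position is odd, the smallest one
when its position is even; adding the two recurrences removes the dependence on the parity. -/
theorem totalWeight_eq_of_recurrence (t q : A) (h2 : IsLeftRegular (2 : A)) (V : ℕ → ℕ → A)
    (V0 : ∀ p, V p 0 = 1)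
    (Vs : ∀ p n, 2 * V p (n + 1) = ∑ b ∈ Finset.range (n + 1), (n.choose b : A) *
      ((cutWeight t q p b (n - b) + 1) * (V p b * V (p + b + 1) (n - b))))
    (s : Finset α) (p : ℕ) : totalWeight t q p s = V p s.card := by
  induction hn : s.card using Nat.strong_induction_on generalizing s p with
  | _ n ih =>
  rcases n with _ | n
  · rw [Finset.card_eq_zero] at hn
    subst hn
    have : arrangements (∅ : Finset α) = {[]} := by
      ext l
      rw [mem_arrangements, List.toFinset_eq_empty_iff, Finset.mem_singleton]
      exact ⟨fun h => h.2, fun h => by simp [h]⟩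
    rw [totalWeight, this, V0]
    simp [altWeight]
  · have step : ∀ (Q : ℕ → Prop) [DecidablePred Q] (m : α) (_ : m ∈ s)
        (_ : ∀ a ∈ s.erase m, ∀ i, AltDrop i a m ↔ Q (i + 1))
        (_ : ∀ a ∈ s.erase m, ∀ i, AltDrop i m a ↔ Q i),
        totalWeight t q p s = ∑ b ∈ Finset.range (n + 1), (n.choose b : A) *
          ((if Q (p + b + 1) then cutWeight t q p b (n - b) else 1) *
            (V p b * V (p + b + 1) (n - b))) := by
      intro Q _ m hm h₁ h₂
      have hc : (s.erase m).card = n := by rw [Finset.card_erase_of_mem hm, hn]; rfl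
      conv_lhs => rw [← Finset.insert_erase hm]
      rw [totalWeight_insert t q Q m _ (Finset.notMem_erase m s) p h₁ h₂, hc]
      have key := Finset.sum_powerset_apply_card
        (fun b => (if Q (p + b + 1) then cutWeight t q p b (n - b) else 1) *
            (V p b * V (p + b + 1) (n - b))) (x := s.erase m)
      simp only [hc, nsmul_eq_mul] at key
      rw [← key]
      refine Finset.sum_congr rfl fun T hT => ?_
      rw [Finset.mem_powerset] at hT
      have hle := Finset.card_le_card hT
      rw [hc] at hle
      have hd : (s.erase m \ T).card = n - T.card := by
        rw [Finset.card_sdiff_of_subset hT, hc]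
      rw [ih T.card (by omega) T p rfl, ih (n - T.card) (by omega) _ _ hd]
    have hne : s.Nonempty := by rw [← Finset.card_pos]; omega
    -- A position `i` before the maximum is an alternating descent iff `i` is even, a position `i`
    -- at the maximum iff `i` is odd: both mean that the maximum sits at an odd position.
    have hmax := step Odd (s.max' hne) (s.max'_mem hne)
      (fun a ha i => by
        have := Finset.lt_max'_of_mem_erase_max' s hne ha
        simp [AltDrop, this, this.not_gt, Nat.odd_add_one])
      (fun a ha i => by
        have := Finset.lt_max'_of_mem_erase_max' s hne ha
        simp [AltDrop, this, this.not_gt])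
    have hmin := step Even (s.min' hne) (s.min'_mem hne)
      (fun a ha i => by
        have := Finset.min'_lt_of_mem_erase_min' s hne ha
        simp [AltDrop, this, this.not_gt, Nat.even_add_one])
      (fun a ha i => by
        have := Finset.min'_lt_of_mem_erase_min' s hne ha
        simp [AltDrop, this, this.not_gt])
    apply h2
    change 2 * _ = 2 * _
    rw [Vs, two_mul]
    nth_rewrite 1 [hmax]
    rw [hmin, ← Finset.sum_add_distrib]
    refine Finset.sum_congr rfl fun b _ => ?_
    rcases Nat.even_or_odd (p + b + 1) with h | h
    · rw [if_neg (Nat.not_odd_iff_even.2 h), if_pos h]; ring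
    · rw [if_pos h, if_neg (Nat.not_even_iff_odd.2 h)]; ring

theorem altWeight_ofFn (t q : A) (k p : ℕ) (f : Fin (k + 1) → α) :
    altWeight t q p (List.ofFn f) =
      ∏ i : Fin k, if AltDrop (p + i) (f i.castSucc) (f i.succ) then t * q ^ (p + (i : ℕ)) else 1 := by
  induction k generalizing p with
  | zero => simp [altWeight]
  | succ k ih =>
    rw [List.ofFn_succ, List.ofFn_succ, altWeight, ← List.ofFn_succ (f := fun i => f i.succ),
      ih (p + 1) (fun i => f i.succ), Fin.prod_univ_succ]
    exact congrArg₂ (· * ·) (if_congr (by simp) (by simp) rfl)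
      (Finset.prod_congr rfl fun i _ => by simp [add_comm, add_left_comm])

theorem altWeight_perm (t q : A) {n : ℕ} (π : Equiv.Perm (Fin n)) :
    altWeight t q 1 (List.ofFn π) = t ^ altdes π * q ^ altmaj π := by
  have h : t ^ altdes π * q ^ altmaj π =
      ∏ i ∈ Finset.Ico 1 n, if IsAltDescent π i then t * q ^ i else 1 := by
    rw [← Finset.prod_filter, Finset.prod_mul_distrib, Finset.prod_const, Finset.prod_pow_eq_pow_sum]
    rfl
  rw [h]
  rcases n with _ | k
  · simp [altWeight]
  · rw [altWeight_ofFn, Finset.prod_Ico_eq_prod_range, Nat.add_sub_cancel, Finset.prod_range]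
    refine Finset.prod_congr rfl fun i _ => ?_
    have : IsAltDescent π (1 + i) ↔ AltDrop (1 + i) (π i.castSucc) (π i.succ) := by
      constructor
      · rintro ⟨a, b, ha, hb, h⟩
        obtain rfl : a = i.castSucc := Fin.ext (by simp; omega)
        obtain rfl : b = i.succ := Fin.ext (by simp; omega)
        exact h
      · intro h
        exact ⟨i.castSucc, i.succ, by simp; omega, by simp; omega, h⟩
    simp only [this]

theorem sum_perm_eq_totalWeight (t q : A) (n : ℕ) :
    ∑ π : Equiv.Perm (Fin n), t ^ altdes π * q ^ altmaj π =
      totalWeight t q 0 (Finset.univ : Finset (Fin n)) := by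
  rw [totalWeight]
  refine Finset.sum_bij (fun π _ => List.ofFn π) ?_ ?_ ?_ ?_
  · intro π _
    rw [mem_arrangements]
    refine ⟨List.nodup_ofFn.2 π.injective, ?_⟩
    ext a
    simp [List.mem_ofFn']
  · intro π _ σ _ h
    exact DFunLike.coe_injective (List.ofFn_injective h)
  · intro l hl
    have hlen := length_of_mem_arrangements hl
    rw [mem_arrangements] at hl
    rw [Finset.card_univ, Fintype.card_fin] at hlen
    have hinj : Function.Injective fun i : Fin n => l.get (Fin.cast hlen.symm i) :=
      (List.nodup_iff_injective_get.1 hl.1).comp (Fin.cast_injective _)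
    refine ⟨Equiv.ofBijective _ (Finite.injective_iff_bijective.1 hinj), Finset.mem_univ _, ?_⟩
    refine List.ext_getElem (by simp [hlen]) fun i _ _ => by simp
  · intro π _
    exact (altWeight_perm t q π).symm

end Words

/-! ### Products of rescaled power series -/

section Series

open PowerSeries

variable {R : Type*} [CommRing R]

/-- The product `G(x) G(qx) ⋯ G(q ^ (k - 1) x)`. -/
noncomputable def qProd (q : R) (G : PowerSeries R) (k : ℕ) : PowerSeries R :=
  ∏ j ∈ Finset.range k, rescale (q ^ j) G

theorem qProd_mul_rescale (q : R) (G : PowerSeries R) (j l : ℕ) :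
    qProd q G j * rescale (q ^ j) (qProd q G l) = qProd q G (j + l) := by
  rw [qProd, qProd, qProd, Finset.prod_range_add, map_prod]
  refine congrArg _ (Finset.prod_congr rfl fun i _ => ?_)
  rw [rescale_rescale, pow_add, mul_comm]

theorem derivative_rescale (c : R) (f : PowerSeries R) :
    derivative R (rescale c f) = C c * rescale c (derivative R f) := by
  ext n
  rw [coeff_C_mul, coeff_rescale, coeff_derivative, coeff_derivative, coeff_rescale]
  ring

/-- The Riccati equation `2 G' = 1 + G ^ 2` makes the derivative of a product of rescalings of `G`
a sum of products of two such products: differentiating one factor either deletes or doubles it. -/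
theorem two_mul_derivative_qProd (q : R) (G : PowerSeries R)
    (hG : 2 * derivative R G = 1 + G ^ 2) (k : ℕ) :
    2 * derivative R (qProd q G k) = ∑ j ∈ Finset.range k, C (q ^ j) *
      (qProd q G j * rescale (q ^ (j + 1)) (qProd q G (k - 1 - j)) +
        qProd q G (j + 1) * rescale (q ^ j) (qProd q G (k - j))) := by
  induction k with
  | zero => simp [qProd]
  | succ k ih =>
    have hs : ∀ m, qProd q G (m + 1) = qProd q G m * rescale (q ^ m) G := fun m => by
      rw [qProd, Finset.prod_range_succ, ← qProd]
    have hG' : 2 * rescale (q ^ k) (derivative R G) = 1 + (rescale (q ^ k) G) ^ 2 := by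
      have := congrArg (rescale (q ^ k)) hG
      rwa [map_mul, map_ofNat, map_add, map_one, map_pow] at this
    have h1 : qProd q G 1 = G := by simp [qProd]
    have h0 : qProd q G 0 = 1 := by simp [qProd]
    have e : 2 * derivative R (qProd q G (k + 1)) =
        (2 * derivative R (qProd q G k)) * rescale (q ^ k) G +
          C (q ^ k) * (qProd q G k * (2 * rescale (q ^ k) (derivative R G))) := by
      rw [hs, Derivation.leibniz, derivative_rescale, smul_eq_mul, smul_eq_mul]
      ring
    rw [e, ih, hG', Finset.sum_range_succ, Finset.sum_mul]
    congr 1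
    · refine Finset.sum_congr rfl fun j hj => ?_
      rw [Finset.mem_range] at hj
      -- The last factor of the tail after the cut at `j` is always the rescaling by `q ^ k`.
      obtain ⟨d, rfl⟩ : ∃ d, k = j + 1 + d := ⟨k - (j + 1), by omega⟩
      rw [show j + 1 + d - 1 - j = d by omega, show j + 1 + d - j = d + 1 by omega,
        show j + 1 + d + 1 - 1 - j = d + 1 by omega, show j + 1 + d + 1 - j = d + 1 + 1 by omega,
        hs (d + 1), hs d]
      simp only [map_mul, rescale_rescale, ← pow_add]
      rw [show d + 1 + j = j + 1 + d by omega, show d + (j + 1) = j + 1 + d by omega]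
      ring
    · rw [show k + 1 - 1 - k = 0 by omega, show k + 1 - k = 1 by omega, hs, h1, h0, map_one]
      ring

/-- The exponential coefficient `n! [xⁿ] G(x) G(qx) ⋯ G(q ^ (k - 1) x)`. -/
noncomputable def qProdCoeff (q : R) (G : PowerSeries R) (n k : ℕ) : R :=
  n.factorial * coeff n (qProd q G k)

/-- Exponential coefficients of a product are binomial convolutions. -/
theorem factorial_mul_coeff_mul_rescale (c : R) (f g : PowerSeries R) (n : ℕ) :
    (n.factorial : R) * coeff n (f * rescale c g) =
      ∑ b ∈ Finset.range (n + 1), (n.choose b : R) * (c ^ b *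
        (((n - b).factorial * coeff (n - b) f) * (b.factorial * coeff b g))) := by
  rw [mul_comm f, coeff_mul, Finset.Nat.sum_antidiagonal_eq_sum_range_succ
    (fun i j => coeff i (rescale c g) * coeff j f), Finset.mul_sum]
  refine Finset.sum_congr rfl fun b hb => ?_
  have hb' : b ≤ n := by rw [Finset.mem_range] at hb; omega
  rw [coeff_rescale, ← Nat.choose_mul_factorial_mul_factorial hb']
  push_cast
  ring

theorem two_mul_qProdCoeff (q : R) (G : PowerSeries R)
    (hG : 2 * derivative R G = 1 + G ^ 2) (n k : ℕ) :
    2 * qProdCoeff q G (n + 1) (k + 1) = ∑ j ∈ Finset.range (k + 1), q ^ j *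
      ∑ b ∈ Finset.range (n + 1), (n.choose b : R) *
        ((q ^ (j + 1)) ^ b * (qProdCoeff q G (n - b) j * qProdCoeff q G b (k - j)) +
          (q ^ j) ^ b * (qProdCoeff q G (n - b) (j + 1) * qProdCoeff q G b (k - j + 1))) := by
  have h := congrArg (fun f => (n.factorial : R) * coeff n f)
    (two_mul_derivative_qProd q G hG (k + 1))
  beta_reduce at h
  have e : (n.factorial : R) * coeff n (2 * derivative R (qProd q G (k + 1))) =
      2 * qProdCoeff q G (n + 1) (k + 1) := by
    rw [show (2 : PowerSeries R) = C 2 from (map_ofNat C 2).symm, coeff_C_mul, coeff_derivative, qProdCoeff,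
      Nat.factorial_succ]
    push_cast
    ring
  rw [← e, h, map_sum, Finset.mul_sum]
  refine Finset.sum_congr rfl fun j hj => ?_
  rw [Finset.mem_range] at hj
  rw [coeff_C_mul, map_add, mul_left_comm, mul_add, factorial_mul_coeff_mul_rescale,
    factorial_mul_coeff_mul_rescale, ← Finset.sum_add_distrib]
  refine congrArg _ (Finset.sum_congr rfl fun b _ => ?_)
  rw [show k + 1 - 1 - j = k - j by omega, show k + 1 - j = k - j + 1 by omega]
  simp only [qProdCoeff]
  ring

/-- The series `∑ₖ Tᵏ n! [xⁿ] G(x) G(qx) ⋯ G(qᵏ x)`. -/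
noncomputable def qSeries (q : R) (G : PowerSeries R) (n : ℕ) : PowerSeries R :=
  mk fun k => qProdCoeff q G n (k + 1)

/-- The variant of `qSeries` in which the coefficient of `Tᵏ` uses only `k` factors. -/
noncomputable def qSeriesPred (q : R) (G : PowerSeries R) (n : ℕ) : PowerSeries R :=
  mk fun k => qProdCoeff q G n k

theorem qProdCoeff_zero (q : R) (G : PowerSeries R) (hG : constantCoeff G = 1) (k : ℕ) :
    qProdCoeff q G 0 k = 1 := by
  have h : ∀ j, constantCoeff (rescale (q ^ j) G) = 1 := fun j => by
    rw [← coeff_zero_eq_constantCoeff_apply, coeff_rescale, coeff_zero_eq_constantCoeff_apply, hG,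
      pow_zero, one_mul]
  simp [qProdCoeff, qProd, map_prod, h]

/-- The two series differ by a shift of the index `k`, except that for `n = 0` both are the
geometric series, since the empty product also has constant coefficient `1`. -/
theorem qSeriesPred_eq (q : R) (G : PowerSeries R) (hG : constantCoeff G = 1) (n : ℕ) :
    qSeriesPred q G n = (if n = 0 then 1 else X) * qSeries q G n := by
  ext k
  rcases n with _ | n
  · simp [qSeriesPred, qSeries, qProdCoeff_zero q G hG]
  · rcases k with _ | k
    · simp [qSeriesPred, qProdCoeff, qProd]
    · simp [qSeriesPred, qSeries, coeff_succ_X_mul]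

theorem two_mul_qSeries_succ (q : R) (G : PowerSeries R)
    (hG : 2 * derivative R G = 1 + G ^ 2) (n : ℕ) :
    2 * qSeries q G (n + 1) = ∑ b ∈ Finset.range (n + 1), (n.choose b : PowerSeries R) *
      (C (q ^ b) * (rescale (q ^ (b + 1)) (qSeriesPred q G (n - b)) * qSeriesPred q G b) +
        rescale (q ^ (b + 1)) (qSeries q G (n - b)) * qSeries q G b) := by
  ext k
  rw [show (2 : PowerSeries R) = C 2 from (map_ofNat C 2).symm, coeff_C_mul, map_sum]
  simp only [qSeries, qSeriesPred]
  rw [coeff_mk, two_mul_qProdCoeff q G hG]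
  simp only [Finset.mul_sum]
  rw [Finset.sum_comm]
  refine Finset.sum_congr rfl fun b _ => ?_
  rw [← map_natCast (C (R := R)), coeff_C_mul, map_add, coeff_C_mul, coeff_mul, coeff_mul,
    Finset.Nat.sum_antidiagonal_eq_sum_range_succ_mk,
    Finset.Nat.sum_antidiagonal_eq_sum_range_succ_mk, Finset.mul_sum, ← Finset.sum_add_distrib,
    Finset.mul_sum]
  refine Finset.sum_congr rfl fun j _ => ?_
  simp only [coeff_rescale, coeff_mk]
  rw [← pow_mul, ← pow_mul, ← pow_mul]
  ring

/-- The numerator of `qSeries`: its product with `(1 - T)(1 - qT) ⋯ (1 - qⁿ T)`. -/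
noncomputable def qNumerator (q : R) (G : PowerSeries R) (n : ℕ) : PowerSeries R :=
  qProd q (1 - X) (n + 1) * qSeries q G n

theorem qNumerator_zero (q : R) (G : PowerSeries R) (hG : constantCoeff G = 1) :
    qNumerator q G 0 = 1 := by
  have : qSeries q G 0 = mk 1 := by
    ext k
    simp [qSeries, qProdCoeff_zero q G hG]
  rw [qNumerator, this, mul_comm]
  simpa [qProd] using mk_one_mul_one_sub_eq_one R

theorem rescale_C_apply (c r : R) : rescale c (C r) = C r := by
  ext n
  rw [coeff_rescale, coeff_C]
  split_ifs with h <;> simp [h]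

theorem cutWeight_eq_rescale (q : R) (p b a : ℕ) :
    cutWeight (X : PowerSeries R) (C q) p b a =
      rescale (q ^ p) (cutWeight (X : PowerSeries R) (C q) 0 b a) := by
  simp only [cutWeight, map_mul, apply_ite (rescale (q ^ p)), map_one, rescale_X, map_pow,
    rescale_C_apply]
  congr 2 <;> ring

theorem two_mul_qNumerator_succ (q : R) (G : PowerSeries R) (h1 : constantCoeff G = 1)
    (hG : 2 * derivative R G = 1 + G ^ 2) (n : ℕ) :
    2 * qNumerator q G (n + 1) = ∑ b ∈ Finset.range (n + 1), (n.choose b : PowerSeries R) *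
      ((cutWeight (X : PowerSeries R) (C q) 0 b (n - b) + 1) *
        (qNumerator q G b * rescale (q ^ (b + 1)) (qNumerator q G (n - b)))) := by
  rw [qNumerator, mul_left_comm, two_mul_qSeries_succ q G hG, Finset.mul_sum]
  refine Finset.sum_congr rfl fun b hb => ?_
  have hn : n + 1 + 1 = b + 1 + (n - b + 1) := by rw [Finset.mem_range] at hb; omega
  have hc : cutWeight (X : PowerSeries R) (C q) 0 b (n - b) = C (q ^ b) *
      (rescale (q ^ (b + 1)) (if n - b = 0 then 1 else X) * (if b = 0 then 1 else X)) := by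
    simp only [cutWeight, apply_ite (rescale (q ^ (b + 1))), map_one, rescale_X, map_pow]
    rcases Nat.eq_zero_or_pos b with rfl | hb0
    · split_ifs <;> simp [mul_comm]
    · rw [if_neg hb0.ne', if_neg hb0.ne']
      split_ifs <;> ring
  rw [hn, ← qProd_mul_rescale, qSeriesPred_eq q G h1, qSeriesPred_eq q G h1, hc, qNumerator,
    qNumerator, map_mul, map_mul]
  ring

/-- The numerators are the total weights: rescaling by `q ^ p` accounts for a first letter at
position `p + 1`. -/
theorem totalWeight_eq_qNumerator {α : Type*} [LinearOrder α] (q : R) (G : PowerSeries R)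
    (h2 : IsLeftRegular (2 : PowerSeries R)) (h1 : constantCoeff G = 1)
    (hG : 2 * derivative R G = 1 + G ^ 2) (s : Finset α) :
    totalWeight (X : PowerSeries R) (C q) 0 s = qNumerator q G s.card := by
  rw [totalWeight_eq_of_recurrence X (C q) h2 (fun p n => rescale (q ^ p) (qNumerator q G n))]
  · simp
  · intro p
    rw [qNumerator_zero q G h1, map_one]
  · intro p n
    have := congrArg (rescale (q ^ p)) (two_mul_qNumerator_succ q G h1 hG n)
    rw [map_mul, map_ofNat, map_sum] at this
    rw [this]
    refine Finset.sum_congr rfl fun b _ => ?_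
    rw [map_mul, map_natCast, map_mul, map_add, map_one, ← cutWeight_eq_rescale, map_mul,
      rescale_rescale, ← pow_add, show b + 1 + p = p + b + 1 by omega]

end Series

/-! ### The Riccati equation of `sec + tan` -/

section SecTan

open PowerSeries

variable (K : Type*) [Field K] [CharZero K]

theorem derivative_sin : derivative K (sin K) = cos K := by
  ext n
  rw [coeff_derivative, sin, cos, coeff_mk, coeff_mk]
  by_cases h : Even n
  · have h' : ¬ Even (n + 1) := by rw [Nat.even_add_one]; exact not_not.2 h
    have e : (n + 1) / 2 = n / 2 := by obtain ⟨m, rfl⟩ := h; omega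
    have hn : (n : K) + 1 ≠ 0 := by exact_mod_cast Nat.succ_ne_zero n
    rw [if_neg h', if_pos h, e, Nat.factorial_succ]
    simp only [map_div₀, map_pow, map_neg, map_one, map_natCast]
    push_cast
    field_simp
  · rw [if_pos (Nat.even_add_one.2 h), if_neg h, zero_mul]

theorem derivative_cos : derivative K (cos K) = -sin K := by
  ext n
  rw [coeff_derivative, map_neg, sin, cos, coeff_mk, coeff_mk]
  by_cases h : Even n
  · have h' : ¬ Even (n + 1) := by rw [Nat.even_add_one]; exact not_not.2 h
    rw [if_neg h', if_pos h, zero_mul, neg_zero]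
  · have e : (n + 1) / 2 = n / 2 + 1 := by
      obtain ⟨m, rfl⟩ := Nat.not_even_iff_odd.1 h; omega
    have hn : (n : K) + 1 ≠ 0 := by exact_mod_cast Nat.succ_ne_zero n
    rw [if_pos (Nat.even_add_one.2 h), if_neg h, e, Nat.factorial_succ]
    simp only [map_div₀, map_pow, map_neg, map_one, map_natCast]
    push_cast
    field_simp
    ring

theorem constantCoeff_sin : constantCoeff (sin K) = 0 := by
  rw [← coeff_zero_eq_constantCoeff_apply, sin, coeff_mk]; simp

theorem constantCoeff_cos : constantCoeff (cos K) = 1 := by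
  rw [← coeff_zero_eq_constantCoeff_apply, cos, coeff_mk]; simp

theorem sin_sq_add_cos_sq_powerSeries : sin K ^ 2 + cos K ^ 2 = 1 := by
  apply derivative.ext
  · rw [map_add, derivative_pow, derivative_pow, derivative_sin, derivative_cos, derivative_one]
    push_cast
    ring
  · simp [constantCoeff_sin, constantCoeff_cos]

/-- The product `cos * (sec + tan)`, free of inverses and hence easy to differentiate. -/
theorem cos_mul_secTan : cos K * (secSeries K + tanSeries K) = 1 + sin K := by
  have h : cos K * (cos K)⁻¹ = 1 := PowerSeries.mul_inv_cancel _ (by simp [constantCoeff_cos])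
  rw [secSeries, tanSeries]
  linear_combination (1 + sin K) * h

theorem constantCoeff_secTan : constantCoeff (secSeries K + tanSeries K) = 1 := by
  have := congrArg constantCoeff (cos_mul_secTan K)
  simpa [constantCoeff_sin, constantCoeff_cos] using this

theorem two_mul_derivative_secTan :
    2 * derivative K (secSeries K + tanSeries K) = 1 + (secSeries K + tanSeries K) ^ 2 := by
  have h0 : cos K ≠ 0 := fun h => by
    have := constantCoeff_cos K
    rw [h, map_zero] at this
    exact zero_ne_one this
  have h1 := cos_mul_secTan K
  generalize secSeries K + tanSeries K = F at *
  have h2 := congrArg (derivative K) h1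
  rw [Derivation.leibniz, derivative_cos, map_add, derivative_one, derivative_sin, smul_eq_mul,
    smul_eq_mul] at h2
  have h3 := sin_sq_add_cos_sq_powerSeries K
  apply mul_left_cancel₀ (pow_ne_zero 2 h0)
  linear_combination 2 * cos K * h2 + (2 * sin K - 1 - sin K - cos K * F) * h1 + h3

end SecTan

/-! ### Evaluation in the ring of power series in `x`, `t`, `q` -/

section Evaluation

open PowerSeries

variable {σ K : Type*} [Field K]

/-- The image of a series over `K` among the series over `K⟦σ⟧`. -/
noncomputable def liftSeries (σ : Type*) (F : PowerSeries K) : PowerSeries (MvPowerSeries σ K) :=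
  PowerSeries.map (MvPowerSeries.C (σ := σ)) F

theorem constantCoeff_liftSeries (F : PowerSeries K) (h : constantCoeff F = 1) :
    constantCoeff (liftSeries σ F) = 1 := by
  rw [← coeff_zero_eq_constantCoeff_apply, liftSeries, coeff_map,
    coeff_zero_eq_constantCoeff_apply, h, map_one]

theorem riccati_liftSeries (F : PowerSeries K) (h : 2 * derivative K F = 1 + F ^ 2) :
    2 * derivative (MvPowerSeries σ K) (liftSeries σ F) = 1 + liftSeries σ F ^ 2 := by
  have hd : derivative (MvPowerSeries σ K) (liftSeries σ F) =
      liftSeries σ (derivative K F) := by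
    ext1 n
    rw [coeff_derivative, liftSeries, liftSeries, coeff_map, coeff_map, coeff_derivative]
    simp
  have := congrArg (liftSeries σ) h
  rw [hd]
  simpa only [liftSeries, map_mul, map_ofNat, map_add, map_one, map_pow] using this

theorem isLeftRegular_two [CharZero K] :
    IsLeftRegular (2 : PowerSeries (MvPowerSeries σ K)) := by
  have h : IsUnit (2 : K) := IsUnit.mk0 _ two_ne_zero
  have := (h.map (MvPowerSeries.C (σ := σ))).map (PowerSeries.C (R := MvPowerSeries σ K))
  rw [map_ofNat, map_ofNat] at this
  exact this.isRegular.left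

/-- If `f (n, k)` is divisible by `X sⁿ` and `X uᵏ`, then each monomial occurs in finitely many
terms. -/
theorem summable_of_forall_dvd [TopologicalSpace K] (s u : σ) (f : ℕ × ℕ → MvPowerSeries σ K)
    (h : ∀ p, MvPowerSeries.X s ^ p.1 ∣ f p ∧ MvPowerSeries.X u ^ p.2 ∣ f p) : Summable f := by
  rw [MvPowerSeries.WithPiTopology.summable_iff_summable_coeff]
  intro d
  refine summable_of_ne_finset_zero (s := Finset.range (d s + 1) ×ˢ Finset.range (d u + 1)) ?_
  intro p hp
  rw [Finset.mem_product, Finset.mem_range, Finset.mem_range, not_and_or] at hp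
  rcases hp with hp | hp
  · exact MvPowerSeries.X_pow_dvd_iff.1 (h p).1 d (by omega)
  · exact MvPowerSeries.X_pow_dvd_iff.1 (h p).2 d (by omega)

variable [UniformSpace K] [DiscreteUniformity K]

/-- Evaluation of power series over `K⟦σ⟧` at an element with zero constant coefficient. -/
theorem exists_evaluation (a : MvPowerSeries σ K) (ha : MvPowerSeries.constantCoeff a = 0) :
    ∃ ψ : PowerSeries (MvPowerSeries σ K) →+* MvPowerSeries σ K,
      (∀ f, HasSum (fun d => coeff d f * a ^ d) (ψ f)) ∧ ψ X = a ∧ ∀ r, ψ (C r) = r := by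
  have hev : HasEval a :=
    MvPowerSeries.WithPiTopology.isTopologicallyNilpotent_of_constantCoeff_zero ha
  have hid : Continuous (RingHom.id (MvPowerSeries σ K)) := continuous_id
  refine ⟨eval₂Hom hid hev, fun f => ?_, ?_, fun r => ?_⟩
  · rw [coe_eval₂Hom]; exact hasSum_eval₂ hid hev f
  · rw [coe_eval₂Hom, eval₂_X]
  · rw [coe_eval₂Hom, eval₂_C]; rfl

theorem hasSum_subst (a : MvPowerSeries σ K) (ha : MvPowerSeries.constantCoeff a = 0)
    (F : PowerSeries K) :
    HasSum (fun d => MvPowerSeries.C (coeff d F) * a ^ d) (PowerSeries.subst a F) := by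
  have hs : HasSubst a := HasSubst.of_constantCoeff_zero ha
  have := hasSum_aeval hs.hasEval F
  rw [← substAlgHom_eq_aeval hs, coe_substAlgHom] at this
  simpa only [MvPowerSeries.smul_eq_C_mul] using this

end Evaluation

/-! ### The double family and its two iterated sums -/

section DoubleFamily

open PowerSeries

variable (K : Type*) [Field K] [CharZero K]

/-- The double family whose sums along rows and columns are the two sides of the identity. -/
noncomputable def doubleTerm (n k : ℕ) : MvPowerSeries (Fin 3) K :=
  coeff n (qProd (varQ K) (liftSeries (Fin 3) (secSeries K + tanSeries K)) (k + 1)) *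
    varX K ^ n * varT K ^ k

variable [UniformSpace K] [DiscreteUniformity K]

theorem hasSum_doubleTerm_secTanTerm (k : ℕ) :
    HasSum (fun n => doubleTerm K n k) (secTanTerm K k) := by
  obtain ⟨ψ, hψ, -, -⟩ := exists_evaluation (varX K) (MvPowerSeries.constantCoeff_X _)
  have hsub : ∀ j, PowerSeries.subst (varX K * varQ K ^ j) (secSeries K) +
      PowerSeries.subst (varX K * varQ K ^ j) (tanSeries K) =
      ψ (rescale (varQ K ^ j) (liftSeries (Fin 3) (secSeries K + tanSeries K))) := fun j => by
    have h0 : MvPowerSeries.constantCoeff (varX K * varQ K ^ j) = 0 := by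
      rw [map_mul, varX, MvPowerSeries.constantCoeff_X, zero_mul]
    rw [← subst_add (HasSubst.of_constantCoeff_zero h0)]
    refine (hasSum_subst _ h0 _).unique ?_
    convert hψ (rescale (varQ K ^ j) (liftSeries (Fin 3) (secSeries K + tanSeries K))) using 2
    rw [coeff_rescale, liftSeries, coeff_map]
    ring
  rw [secTanTerm, Finset.prod_congr rfl fun j _ => hsub j, ← map_prod, mul_comm]
  exact (hψ _).mul_right _

theorem hasSum_doubleTerm_altTerm (n : ℕ) :
    HasSum (fun k => doubleTerm K n k) (altTerm K n) := by
  obtain ⟨ψ, hψ, hX, hC⟩ := exists_evaluation (varT K) (MvPowerSeries.constantCoeff_X _)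
  set G := liftSeries (Fin 3) (secSeries K + tanSeries K) with hG
  have hnum : ∑ π : Equiv.Perm (Fin n), varT K ^ altdes π * varQ K ^ altmaj π =
      ψ (qNumerator (varQ K) G n) := by
    have := totalWeight_eq_qNumerator (varQ K) G isLeftRegular_two
      (constantCoeff_liftSeries _ (constantCoeff_secTan K))
      (riccati_liftSeries _ (two_mul_derivative_secTan K)) (Finset.univ : Finset (Fin n))
    rw [Finset.card_univ, Fintype.card_fin] at this
    rw [← this, ← sum_perm_eq_totalWeight, map_sum]
    simp [hX, hC]
  have hden : ψ (qProd (varQ K) (1 - X) (n + 1)) =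
      ∏ i ∈ Finset.range (n + 1), (1 - varT K * varQ K ^ i) := by
    rw [qProd, map_prod]
    refine Finset.prod_congr rfl fun i _ => ?_
    rw [map_sub, map_one, rescale_X, map_sub, map_one, map_mul, hX, hC, mul_comm]
  have hunit : MvPowerSeries.constantCoeff
      (∏ i ∈ Finset.range (n + 1), (1 - varT K * varQ K ^ i)) ≠ 0 := by
    simp [varT, map_prod]
  have hfac : (n.factorial : K) ≠ 0 := by exact_mod_cast n.factorial_ne_zero
  have hquot : altTerm K n = ((n.factorial : K)⁻¹ • varX K ^ n) * ψ (qSeries (varQ K) G n) := by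
    rw [altTerm, hnum, qNumerator, map_mul, hden, mul_right_comm (∏ i ∈ _, _),
      MvPowerSeries.mul_inv_cancel _ hunit, one_mul]
  rw [hquot]
  have hterm : ∀ k, doubleTerm K n k = ((n.factorial : K)⁻¹ • varX K ^ n) *
      (coeff k (qSeries (varQ K) G n) * varT K ^ k) := fun k => by
    rw [doubleTerm, ← hG, qSeries, coeff_mk, qProdCoeff, MvPowerSeries.smul_eq_C_mul,
      ← map_natCast (MvPowerSeries.C (σ := Fin 3) (R := K))]
    have : MvPowerSeries.C (σ := Fin 3) ((n.factorial : K)⁻¹) *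
        MvPowerSeries.C (σ := Fin 3) (n.factorial : K) = 1 := by
      rw [← map_mul, inv_mul_cancel₀ hfac, map_one]
    linear_combination (-(coeff n (qProd (varQ K) G (k + 1)) * varX K ^ n * varT K ^ k)) * this
  simp only [hterm]
  exact (hψ (qSeries (varQ K) G n)).mul_left _

theorem exists_hasSum_altTerm_secTanTerm :
    ∃ a, HasSum (altTerm K) a ∧ HasSum (secTanTerm K) a := by
  obtain ⟨a, ha⟩ := summable_of_forall_dvd (0 : Fin 3) 1 (fun p => doubleTerm K p.1 p.2)
    (fun p => ⟨Dvd.intro_left _ (mul_right_comm _ _ _).symm, Dvd.intro_left _ rfl⟩)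
  refine ⟨a, ha.prod_fiberwise (hasSum_doubleTerm_altTerm K), ?_⟩
  exact ((Equiv.prodComm ℕ ℕ).hasSum_iff.2 ha).prod_fiberwise (hasSum_doubleTerm_secTanTerm K)

end DoubleFamily

/-- Both sums are taken in `K⟦x, t, q⟧` with the topology of coefficientwise convergence over the
discrete field `K`: each coefficient is eventually constant along the partial sums. -/
theorem mainTheorem7 (K : Type*) [Field K] [CharZero K] [TopologicalSpace K] [DiscreteTopology K] :
    Summable (altTerm K) ∧ Summable (secTanTerm K) ∧
      ∑' n : ℕ, altTerm K n = ∑' k : ℕ, secTanTerm K k := by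
  -- The evaluation of power series needs a uniform structure; this choice keeps the given topology.
  have htop : ‹TopologicalSpace K› = (⊥ : UniformSpace K).toTopologicalSpace :=
    DiscreteTopology.eq_bot
  let _ : UniformSpace K := (⊥ : UniformSpace K).replaceTopology htop
  have : DiscreteUniformity K := ⟨UniformSpace.replaceTopology_eq _ htop⟩
  obtain ⟨a, h₁, h₂⟩ := exists_hasSum_altTerm_secTanTerm K
  exact ⟨h₁.summable, h₂.summable, h₁.tsum_eq.trans h₂.tsum_eq.symm⟩
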